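/- For an integer $n\ge 1$ and a real $\alpha>0$, the oblivious decomposition of $[n]=\{1,\dots,n\}$ with parameter $\alpha$ is its partition into consecutive intervals $I_1,\dots,I_\ell$ with $|I_k|=\lfloor(1+\alpha)^k\rfloor$ for $k<\ell$, where $\ell$ is the least integer with $\sum_{k\le \ell}\lfloor(1+\alpha)^k\rfloor\ge n$ and the last interval $I_\ell$ is truncated at $n$. For a probability distribution $D$ on $[n]$, let $\Phi_\alpha(D)$ be the flattened distribution, $\Phi_\alpha(D)(i)=D(I_k)/|I_k|$ for $i\in I_k$, and let $d_{\mathrm{TV}}(P,Q)=\frac12\sum_{i}|P(i)-Q(i)|$. A COND oracle for $D$ takes a query set $S\subseteq[n]$ with $D(S)>0$ and returns a fresh sample $i\in S$, drawn with probability $D(i)/D(S)$ independently of all earlier answers. Lemma. There are absolute constants $C,c$ and a randomized (adaptive) algorithm which, given $n$, $\alpha>0$, $\varepsilon,\delta\in(0,1]$ and COND access to an unknown distribution $D$ on $[n]$, only ever queries sets $S$ with $D(S)>0$, makes at most $$C\,\frac{1}{\varepsilon^{22}}\Bigl(1+\log_2\frac1\varepsilon\Bigr)^{c}\log_2\frac1\delta$$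 queries (that is, $\tilde O\bigl(\varepsilon^{-22}\log\frac1\delta\bigr)$, independently of $n$ and $\alpha$), and outputs a real number $\hat d$ such that, with probability at least $1-\delta$, $\bigl|\hat d-d_{\mathrm{TV}}(D,\Phi_\alpha(D))\bigr|\le\varepsilon$. -/

import Mathlib

open scoped ENNReal

noncomputable section

/-- A randomized algorithm with access to a conditional sampling oracle (COND oracle) for an unknown
distribution on an `n`-element domain, with outputs in `β`.  It is an adaptive randomized decision
tree: at each step it stops with an output, or draws a uniform element of `{0, …, m}` with its
internal randomness (which costs no query), or submits a query set `S` to the oracle and continues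
according to the answer.  The points `1, …, n` of the domain are represented by `Fin n`, the
element `i : Fin n` standing for the point `i + 1`. -/
inductive CondAlgorithm (n : ℕ) (β : Type) : Type
  | output (b : β) : CondAlgorithm n β
  | draw (m : ℕ) (next : Fin (m + 1) → CondAlgorithm n β) : CondAlgorithm n β
  | query (S : Finset (Fin n)) (next : Fin n → CondAlgorithm n β) : CondAlgorithm n β

namespace CondAlgorithm

variable {n : ℕ} {β : Type}

/-- The worst-case number of oracle queries, over all answers and all internal randomness. -/
def queries : CondAlgorithm n β → ℕ
  | output _ => 0
  | draw _ next => Finset.univ.sup fun j => (next j).queries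
  | query _ next => 1 + Finset.univ.sup fun i => (next i).queries

open Classical in
/-- The law of the result when the oracle is the COND oracle of `D`.  A query `S` with `D(S) > 0` is
answered by a fresh sample from the conditional distribution `D_S`; the oracle is not defined on
sets with `D(S) = 0`, and on such a query the run aborts with the result `none`. -/
def run (D : PMF (Fin n)) : CondAlgorithm n β → PMF (Option β)
  | output b => PMF.pure (some b)
  | draw m next => (PMF.uniformOfFintype (Fin (m + 1))).bind fun j => run D (next j)
  | query S next =>
      if h : ∃ i ∈ (S : Set (Fin n)), i ∈ D.support then
        (D.filter (S : Set (Fin n)) h).bind fun i => run D (next i)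
      else PMF.pure none

end CondAlgorithm

/-- Total variation distance of two distributions on `Fin n`, given by their mass functions. -/
def tvDist {n : ℕ} (P Q : Fin n → ℝ) : ℝ := (1 / 2) * ∑ i, |P i - Q i|

/-- The mass function of a distribution, with real values. -/
def massFn {n : ℕ} (D : PMF (Fin n)) (i : Fin n) : ℝ := (D i).toReal

/-- The right end of the `k`-th interval before truncation to the domain: the first `k` intervals
have lengths `⌊(1 + α) ^ j⌋`, `1 ≤ j ≤ k`. -/
def intervalEnd (α : ℝ) (k : ℕ) : ℕ := ∑ j ∈ Finset.Icc 1 k, ⌊(1 + α) ^ j⌋₊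

/-- The number `ℓ` of intervals of the oblivious decomposition: the least one for which they
cover the domain. -/
def numIntervals (n : ℕ) (α : ℝ) : ℕ := sInf {k | n ≤ intervalEnd α k}

/-- The `k`-th interval of the oblivious decomposition, `1 ≤ k ≤ ℓ`: consecutive intervals of
length `⌊(1 + α) ^ k⌋`, the last one truncated at the end of the domain. -/
def obliviousInterval (n : ℕ) (α : ℝ) (k : ℕ) : Finset (Fin n) :=
  {i | intervalEnd α (k - 1) ≤ (i : ℕ) ∧ (i : ℕ) < intervalEnd α k}

/-- The mass function of the flattened distribution: on each interval `I` of the oblivious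
decomposition it has the constant value `D(I) / |I|`. -/
def flattening {n : ℕ} (α : ℝ) (D : PMF (Fin n)) (i : Fin n) : ℝ :=
  ∑ k ∈ Finset.Icc 1 (numIntervals n α),
    if i ∈ obliviousInterval n α k then
      (∑ j ∈ obliviousInterval n α k, massFn D j) / (obliviousInterval n α k).card
    else 0

end

/-! Write `w` for the mass function of `D` and `w̄` for its average over the interval containing
each point. Since `w` and `w̄` have the same total, the distance is the sum of the positive parts of
`w - w̄`, that is, the mean over `x ~ D` of `1 - min(1, w̄ x / w x)`. It therefore suffices to
estimate the ratio `w̄ x / w x` at a sampled point.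

Let `I` be the interval of `x`. Compare `x` with a random `y ∈ I` by querying `{x, y}`. If `y ~
D_I`, then `x` wins with probability `a = w x · S / D(I)`; if `y` is uniform on `I`, then `y` wins
with probability `b = S / |I|`, where `S` is the same sum over `y ∈ I` of `w y / w({x, y})`. The
unknown `S` cancels and `b / a = w̄ x / w x` exactly (`expect_compare_div`).

Empirical frequencies give `b / a` to good accuracy unless `a` is small. If the points of `I` no
heavier than `x` carry a fraction `γ` of `D(I)`, then `a ≥ γ / 2` (`expect_compareSample_ge`); the
points where this fails have total mass at most `γ` (`sum_low_quantile_le`). With `O(ε⁻⁴)`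
comparisons per sampled point the bias is `ε / 2`, and a Chernoff bound lets `O(ε⁻² log(1/δ))`
repetitions control the deviation.

For `δ` near `1` the budget `log(1/δ)` tends to `0`. If `1 - δ ≤ ε / 3`, a random grid point
succeeds often enough without queries; otherwise `log₂(1/δ) > ε / 3`, which costs one more factor
`1/ε`. The total is `O(ε⁻⁷ log(1/δ))`, well within the bound. -/

noncomputable section

/-! ### Calculus of decision trees: composition, reachability, expectation. -/

namespace CondAlgorithm

variable {n : ℕ} {β γ : Type}

/-- Sequential composition. -/
def bind : CondAlgorithm n β → (β → CondAlgorithm n γ) → CondAlgorithm n γ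
  | output b, f => f b
  | draw m next, f => draw m fun j => (next j).bind f
  | query S next, f => query S fun i => (next i).bind f

theorem queries_bind_le {f : β → CondAlgorithm n γ} {k : ℕ} (hf : ∀ b, (f b).queries ≤ k)
    (A : CondAlgorithm n β) : (A.bind f).queries ≤ A.queries + k := by
  induction A with
  | output b => simpa [bind, queries] using hf b
  | draw m next ih =>
    refine Finset.sup_le fun j _ => (ih j).trans ?_
    exact Nat.add_le_add_right (Finset.le_sup (f := fun j => (next j).queries) (Finset.mem_univ j)) k
  | query S next ih =>
    simp only [bind, queries, add_assoc]
    refine Nat.add_le_add_left (Finset.sup_le fun j _ => (ih j).trans ?_) 1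
    exact Nat.add_le_add_right (Finset.le_sup (f := fun j => (next j).queries) (Finset.mem_univ j)) k

/-- With the oracle of the weights `w`, every reachable query has positive weight and every
reachable output satisfies `Q`. -/
def Ensures (w : Fin n → ℝ) (Q : β → Prop) : CondAlgorithm n β → Prop
  | output b => Q b
  | draw _ next => ∀ j, Ensures w Q (next j)
  | query S next => (∃ i ∈ S, 0 < w i) ∧ ∀ i ∈ S, 0 < w i → Ensures w Q (next i)

/-- The expectation of `φ` at the output, with the oracle of the weights `w`. -/
def expect (w : Fin n → ℝ) (φ : β → ℝ) : CondAlgorithm n β → ℝ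
  | output b => φ b
  | draw m next => (∑ j, expect w φ (next j)) / ((m : ℝ) + 1)
  | query S next => (∑ i ∈ S, w i * expect w φ (next i)) / ∑ i ∈ S, w i

section Expectation

variable {w : Fin n → ℝ}

theorem Ensures.mono {Q R : β → Prop} (h : ∀ b, Q b → R b) {A : CondAlgorithm n β}
    (hA : A.Ensures w Q) : A.Ensures w R := by
  induction A with
  | output b => exact h b hA
  | draw m next ih => exact fun j => ih j (hA j)
  | query S next ih => exact ⟨hA.1, fun i hi hw => ih i (hA.2 i hi hw)⟩

theorem Ensures.bind {Q : β → Prop} {R : γ → Prop} {A : CondAlgorithm n β}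
    {f : β → CondAlgorithm n γ} (hA : A.Ensures w Q) (hf : ∀ b, Q b → (f b).Ensures w R) :
    (A.bind f).Ensures w R := by
  induction A with
  | output b => exact hf b hA
  | draw m next ih => exact fun j => ih j (hA j)
  | query S next ih => exact ⟨hA.1, fun i hi hw => ih i (hA.2 i hi hw)⟩

theorem expect_bind (f : β → CondAlgorithm n γ) (φ : γ → ℝ) (A : CondAlgorithm n β) :
    (A.bind f).expect w φ = A.expect w fun b => (f b).expect w φ := by
  induction A with
  | output b => rfl
  | draw m next ih => simp only [CondAlgorithm.bind, expect, ih]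
  | query S next ih => simp only [CondAlgorithm.bind, expect, ih]

theorem expect_add (φ ψ : β → ℝ) (A : CondAlgorithm n β) :
    A.expect w (fun b => φ b + ψ b) = A.expect w φ + A.expect w ψ := by
  induction A with
  | output b => rfl
  | draw m next ih => simp only [expect, ih, Finset.sum_add_distrib, add_div]
  | query S next ih => simp only [expect, ih, mul_add, Finset.sum_add_distrib, add_div]

theorem expect_const_mul (c : ℝ) (φ : β → ℝ) (A : CondAlgorithm n β) :
    A.expect w (fun b => c * φ b) = c * A.expect w φ := by
  induction A with
  | output b => rfl
  | draw m next ih => simp only [expect, ih, ← Finset.mul_sum, mul_div_assoc]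
  | query S next ih =>
    simp only [expect, ih, mul_left_comm _ c, ← Finset.mul_sum, mul_div_assoc]

theorem expect_mul_const (c : ℝ) (φ : β → ℝ) (A : CondAlgorithm n β) :
    A.expect w (fun b => φ b * c) = A.expect w φ * c := by
  simp only [mul_comm _ c, expect_const_mul]

theorem expect_sub (φ ψ : β → ℝ) (A : CondAlgorithm n β) :
    A.expect w (fun b => φ b - ψ b) = A.expect w φ - A.expect w ψ := by
  simpa [sub_eq_add_neg] using (expect_add (w := w) φ (fun b => (-1) * ψ b) A).trans
    (by rw [expect_const_mul, neg_one_mul])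

theorem Ensures.expect_le (hw : ∀ i, 0 ≤ w i) {Q : β → Prop} {φ ψ : β → ℝ}
    (h : ∀ b, Q b → φ b ≤ ψ b) {A : CondAlgorithm n β} (hA : A.Ensures w Q) :
    A.expect w φ ≤ A.expect w ψ := by
  induction A with
  | output b => exact h b hA
  | draw m next ih =>
    simp only [expect]
    gcongr with j _
    exact ih j (hA j)
  | query S next ih =>
    refine div_le_div_of_nonneg_right (Finset.sum_le_sum fun i hi => ?_)
      (Finset.sum_nonneg fun i _ => hw i)
    -- `Ensures` says nothing about branches reached by an answer of weight zero; these contribute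
    -- nothing to the sum.
    rcases (hw i).eq_or_lt with h0 | h0
    · simp [← h0]
    · exact mul_le_mul_of_nonneg_left (ih i (hA.2 i hi h0)) h0.le

theorem sum_pos_of_exists (hw : ∀ i, 0 ≤ w i) {S : Finset (Fin n)} (h : ∃ i ∈ S, 0 < w i) :
    0 < ∑ i ∈ S, w i :=
  Finset.sum_pos' (fun i _ => hw i) h

theorem Ensures.expect_const (hw : ∀ i, 0 ≤ w i) {Q : β → Prop} (c : ℝ)
    {A : CondAlgorithm n β} (hA : A.Ensures w Q) : A.expect w (fun _ => c) = c := by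
  induction A with
  | output b => rfl
  | draw m next ih =>
    have : ((m : ℝ) + 1) ≠ 0 := by positivity
    simp only [expect, ih _ (hA _), Finset.sum_const, Finset.card_univ, Fintype.card_fin,
      nsmul_eq_mul]
    push_cast
    field_simp
  | query S next ih =>
    have : ∀ i ∈ S, w i * (next i).expect w (fun _ => c) = w i * c := by
      intro i hi
      rcases (hw i).eq_or_lt with h0 | h0
      · simp [← h0]
      · rw [ih i (hA.2 i hi h0)]
    simp only [expect]
    rw [Finset.sum_congr rfl this, ← Finset.sum_mul,
      mul_div_cancel_left₀ _ (sum_pos_of_exists hw hA.1).ne']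

theorem Ensures.abs_expect_sub_le (hw : ∀ i, 0 ≤ w i) {Q : β → Prop} {φ : β → ℝ} (c : ℝ)
    {A : CondAlgorithm n β} (hA : A.Ensures w Q) :
    |A.expect w φ - c| ≤ A.expect w fun b => |φ b - c| := by
  have h : A.expect w (fun b => φ b - c) = A.expect w φ - c := by
    rw [expect_sub, hA.expect_const hw]
  rw [← h, abs_le]
  constructor
  · have := hA.expect_le hw (φ := fun b => (-1) * |φ b - c|) (ψ := fun b => φ b - c)
      fun b _ => by linarith [neg_abs_le (φ b - c)]
    rw [expect_const_mul] at this
    linarith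
  · exact hA.expect_le hw fun b _ => le_abs_self _

end Expectation

/-! ### From real expectations back to the law `run`. -/

section Law

variable {D : PMF (Fin n)}

theorem massFn_pos_iff {i : Fin n} : 0 < massFn D i ↔ i ∈ D.support := by
  rw [massFn, ENNReal.toReal_pos_iff, PMF.mem_support_iff, pos_iff_ne_zero]
  exact and_iff_left (D.apply_lt_top i)

theorem massFn_nonneg (i : Fin n) : 0 ≤ massFn D i := ENNReal.toReal_nonneg

theorem sum_massFn : ∑ i, massFn D i = 1 := by
  have h := D.tsum_coe
  rw [tsum_fintype] at h
  simp only [massFn]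
  rw [← ENNReal.toReal_sum fun i _ => D.apply_ne_top i, h, ENNReal.toReal_one]

theorem Ensures.none_notMem_support {Q : β → Prop} {A : CondAlgorithm n β}
    (hA : A.Ensures (massFn D) Q) : none ∉ (A.run D).support := by
  induction A with
  | output b => simp [run]
  | draw m next ih =>
    simp only [run, PMF.mem_support_bind_iff, not_exists, not_and]
    exact fun j _ => ih j (hA j)
  | query S next ih =>
    obtain ⟨⟨i, hi, hwi⟩, hA⟩ := hA
    have h : ∃ i ∈ (S : Set (Fin n)), i ∈ D.support := ⟨i, hi, massFn_pos_iff.1 hwi⟩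
    rw [run, dif_pos h]
    simp only [PMF.mem_support_bind_iff, not_exists, not_and]
    intro j hj
    rw [PMF.mem_support_filter_iff] at hj
    exact ih j (hA j hj.1 (massFn_pos_iff.2 hj.2))

theorem filter_apply_toReal (S : Finset (Fin n)) (h : ∃ i ∈ (S : Set (Fin n)), i ∈ D.support)
    (i : Fin n) : (D.filter (S : Set (Fin n)) h) i =
      ENNReal.ofReal (if i ∈ S then massFn D i / ∑ j ∈ S, massFn D j else 0) := by
  have hpos : 0 < ∑ j ∈ S, massFn D j := by
    obtain ⟨k, hk, hk'⟩ := h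
    exact sum_pos_of_exists massFn_nonneg ⟨k, hk, massFn_pos_iff.2 hk'⟩
  have hs : ∑' j, (S : Set (Fin n)).indicator D j = ENNReal.ofReal (∑ j ∈ S, massFn D j) := by
    rw [ENNReal.ofReal_sum_of_nonneg fun i _ => massFn_nonneg i, tsum_fintype,
      Finset.sum_indicator_subset _ (Finset.subset_univ S)]
    exact Finset.sum_congr rfl fun i _ => (ENNReal.ofReal_toReal (D.apply_ne_top i)).symm
  rw [PMF.filter_apply, hs]
  by_cases hi : i ∈ S
  · rw [Set.indicator_of_mem (Finset.mem_coe.2 hi), if_pos hi, ENNReal.ofReal_div_of_pos hpos,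
      massFn, ENNReal.ofReal_toReal (D.apply_ne_top i), div_eq_mul_inv]
  · rw [Set.indicator_of_notMem (by simpa using hi), if_neg hi]
    simp

theorem expect_nonneg {w : Fin n → ℝ} (hw : ∀ i, 0 ≤ w i) {φ : β → ℝ} (hφ : ∀ b, 0 ≤ φ b)
    (A : CondAlgorithm n β) : 0 ≤ A.expect w φ := by
  induction A with
  | output b => exact hφ b
  | draw m next ih => exact div_nonneg (Finset.sum_nonneg fun j _ => ih j) (by positivity)
  | query S next ih =>
    exact div_nonneg (Finset.sum_nonneg fun i _ => mul_nonneg (hw i) (ih i))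
      (Finset.sum_nonneg fun i _ => hw i)

open Classical in
/-- The probability of an event about the output is the expectation of its indicator. -/
theorem Ensures.toOuterMeasure_run {Q : β → Prop} (P : β → Prop) {A : CondAlgorithm n β}
    (hA : A.Ensures (massFn D) Q) :
    (A.run D).toOuterMeasure {o | ∃ b, o = some b ∧ P b} =
      ENNReal.ofReal (A.expect (massFn D) fun b => if P b then 1 else 0) := by
  have hnn : ∀ b : β, (0 : ℝ) ≤ if P b then 1 else 0 := fun b => by split_ifs <;> norm_num
  induction A with
  | output b =>
    by_cases hb : P b <;> simp [run, expect, PMF.toOuterMeasure_pure_apply, hb]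
  | draw m next ih =>
    rw [run, PMF.toOuterMeasure_bind_apply, tsum_fintype, expect, Finset.sum_div,
      ENNReal.ofReal_sum_of_nonneg fun j _ =>
        div_nonneg (expect_nonneg massFn_nonneg hnn _) (by positivity)]
    refine Finset.sum_congr rfl fun j _ => ?_
    rw [ih j (hA j), ENNReal.ofReal_div_of_pos (by positivity), div_eq_mul_inv, mul_comm,
      PMF.uniformOfFintype_apply, Fintype.card_fin,
      show ((m : ℝ) + 1) = ((m + 1 : ℕ) : ℝ) by push_cast; ring, ENNReal.ofReal_natCast]
  | query S next ih =>
    obtain ⟨⟨i, hi, hwi⟩, hA⟩ := hA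
    have h : ∃ i ∈ (S : Set (Fin n)), i ∈ D.support := ⟨i, hi, massFn_pos_iff.1 hwi⟩
    have hpos := sum_pos_of_exists massFn_nonneg ⟨i, hi, hwi⟩
    rw [run, dif_pos h, PMF.toOuterMeasure_bind_apply, tsum_fintype, expect, Finset.sum_div,
      ENNReal.ofReal_sum_of_nonneg fun j _ => div_nonneg (mul_nonneg (massFn_nonneg j)
        (expect_nonneg massFn_nonneg hnn _)) hpos.le,
      ← Finset.sum_subset (Finset.subset_univ S) fun j _ hj => by
        simp [hj]]
    refine Finset.sum_congr rfl fun j hj => ?_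
    rw [filter_apply_toReal, if_pos hj]
    rcases (massFn_nonneg (D := D) j).eq_or_lt with h0 | h0
    · simp [← h0]
    · rw [ih j (hA j hj h0), ← ENNReal.ofReal_mul (by positivity)]
      congr 1
      ring

end Law

/-! ### Independent repetition: variance and Chernoff bounds. -/

section Repetition

variable {w : Fin n → ℝ}

/-- The sum of the outputs of `k` independent runs. -/
def sumRuns (A : CondAlgorithm n ℝ) : ℕ → CondAlgorithm n ℝ
  | 0 => output 0
  | k + 1 => A.bind fun z => (sumRuns A k).bind fun s => output (z + s)

theorem queries_sumRuns_le (A : CondAlgorithm n ℝ) (k : ℕ) :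
    (A.sumRuns k).queries ≤ k * A.queries := by
  induction k with
  | zero => simp [sumRuns, queries]
  | succ k ih =>
    have h : ∀ z : ℝ, ((A.sumRuns k).bind fun s => output (z + s)).queries ≤ k * A.queries :=
      fun z => (queries_bind_le (k := 0) (fun _ => by simp [queries]) _).trans ih
    exact (queries_bind_le h A).trans (by ring_nf; rfl)

theorem Ensures.sumRuns_nonneg {A : CondAlgorithm n ℝ} (hA : A.Ensures w fun z => 0 ≤ z) (k : ℕ) :
    (A.sumRuns k).Ensures w fun s => 0 ≤ s := by
  induction k with
  | zero => exact le_refl (0 : ℝ)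
  | succ k ih => exact hA.bind fun z hz => ih.bind fun s hs => add_nonneg hz hs

theorem expect_sumRuns_succ (φ : ℝ → ℝ) (A : CondAlgorithm n ℝ) (k : ℕ) :
    (A.sumRuns (k + 1)).expect w φ =
      A.expect w fun z => (A.sumRuns k).expect w fun s => φ (z + s) := by
  simp only [sumRuns, expect_bind]
  rfl

/-- Independence of the runs, in the form needed for Chernoff: the moment generating function of the
centred sum factorises. -/
theorem expect_exp_sumRuns (t μ : ℝ) (A : CondAlgorithm n ℝ) (k : ℕ) :
    (A.sumRuns k).expect w (fun s => Real.exp (t * (s - k * μ))) =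
      (A.expect w fun z => Real.exp (t * (z - μ))) ^ k := by
  induction k with
  | zero => simp [sumRuns, expect]
  | succ k ih =>
    rw [expect_sumRuns_succ, pow_succ', ← ih, ← expect_mul_const]
    congr 1
    funext z
    rw [← expect_const_mul]
    congr 1
    funext s
    rw [← Real.exp_add]
    congr 1
    push_cast
    ring

/-- Variances of independent runs add, and each is at most `1`. The two claims are proved together
because the cross term in the induction vanishes by the first. -/
theorem Ensures.expect_sq_sumRuns_le (hw : ∀ i, 0 ≤ w i) {A : CondAlgorithm n ℝ}
    (hA : A.Ensures w fun z => 0 ≤ z ∧ z ≤ 1) (k : ℕ) :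
    (A.sumRuns k).expect w (fun s => s - k * A.expect w id) = 0 ∧
      (A.sumRuns k).expect w (fun s => (s - k * A.expect w id) ^ 2) ≤ k := by
  set μ := A.expect w id with hμ
  have hμ0 : 0 ≤ μ := by
    simpa [hA.expect_const hw] using hA.expect_le hw (φ := fun _ => 0) (ψ := id) fun b hb => hb.1
  have hμ1 : μ ≤ 1 := by
    simpa [hA.expect_const hw] using hA.expect_le hw (φ := id) (ψ := fun _ => 1) fun b hb => hb.2
  have hc : A.expect w (fun z => z - μ) = 0 := by
    rw [expect_sub, hA.expect_const hw, hμ]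
    exact sub_self _
  induction k with
  | zero => simp [sumRuns, expect]
  | succ k ih =>
    have hS := (hA.mono fun _ hb => hb.1).sumRuns_nonneg k
    obtain ⟨ih1, ih2⟩ := ih
    constructor
    · rw [expect_sumRuns_succ, ← hc]
      congr 1
      funext z
      rw [show (fun s => z + s - ((k + 1 : ℕ) : ℝ) * μ) = fun s => (z - μ) + (s - k * μ) by
        funext s; push_cast; ring, expect_add, hS.expect_const hw, ih1, add_zero]
    · have : ∀ z, (A.sumRuns k).expect w (fun s => (z + s - ((k + 1 : ℕ) : ℝ) * μ) ^ 2) =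
          (z - μ) ^ 2 + (A.sumRuns k).expect w (fun s => (s - k * μ) ^ 2) := by
        intro z
        rw [show (fun s => (z + s - ((k + 1 : ℕ) : ℝ) * μ) ^ 2) =
          fun s => ((z - μ) ^ 2 + (2 * (z - μ)) * (s - k * μ)) + (s - k * μ) ^ 2 by
          funext s; push_cast; ring, expect_add, expect_add, hS.expect_const hw,
          expect_const_mul, ih1, mul_zero, add_zero]
      rw [expect_sumRuns_succ]
      simp only [this]
      rw [expect_add, hA.expect_const hw]
      have h1 : A.expect w (fun z => (z - μ) ^ 2) ≤ 1 := by
        have := hA.expect_le hw (φ := fun z => (z - μ) ^ 2) (ψ := fun _ => 1)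
          fun z hz => by nlinarith [hz.1, hz.2]
        rwa [hA.expect_const hw] at this
      push_cast
      linarith

/-- The mean absolute deviation of an empirical mean of `k ≥ τ⁻²` runs. -/
theorem Ensures.expect_abs_sumRuns_le (hw : ∀ i, 0 ≤ w i) {A : CondAlgorithm n ℝ}
    (hA : A.Ensures w fun z => 0 ≤ z ∧ z ≤ 1) {k : ℕ} {τ : ℝ} (hτ : 0 < τ)
    (hk : 1 ≤ τ ^ 2 * k) :
    (A.sumRuns k).expect w (fun s => |s / k - A.expect w id|) ≤ τ := by
  set μ := A.expect w id
  have hS := (hA.mono fun _ hb => hb.1).sumRuns_nonneg k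
  have hk0 : (0 : ℝ) < k := by
    rcases Nat.eq_zero_or_pos k with h | h
    · subst h; norm_num at hk
    · exact_mod_cast h
  -- The inequality `|u| ≤ u² / (2τ) + τ / 2` replaces Cauchy–Schwarz, so that the variance bound
  -- suffices.
  have key : ∀ s : ℝ, |s / k - μ| ≤ 1 / (2 * τ * k ^ 2) * (s - k * μ) ^ 2 + τ / 2 := by
    intro s
    have h1 : 1 / (2 * τ * k ^ 2) * (s - k * μ) ^ 2 = |s / k - μ| ^ 2 / (2 * τ) := by
      rw [sq_abs]
      field_simp
    rw [h1, div_add' _ _ _ (by positivity), le_div_iff₀ (by positivity)]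
    nlinarith [sq_nonneg (|s / k - μ| - τ)]
  refine (hS.expect_le hw fun s _ => key s).trans ?_
  rw [expect_add, expect_const_mul, hS.expect_const hw]
  have h2 := (hA.expect_sq_sumRuns_le hw k).2
  have h3 : 1 / (2 * τ * k ^ 2) * (A.sumRuns k).expect w (fun s => (s - k * μ) ^ 2) ≤
      1 / (2 * τ * k ^ 2) * k := by gcongr
  have h4 : 1 / (2 * τ * k ^ 2) * (k : ℝ) ≤ τ / 2 := by
    rw [div_mul_eq_mul_div, div_le_div_iff₀ (by positivity) (by positivity)]
    nlinarith
  linarith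

/-- For `|u| ≤ 1` one has `exp u ≤ 1 + u + u²`; taking `u = t (z - μ)`, the linear term has mean
zero, and `1 + t² ≤ exp (t²)`. -/
theorem Ensures.expect_exp_le (hw : ∀ i, 0 ≤ w i) {A : CondAlgorithm n ℝ}
    (hA : A.Ensures w fun z => 0 ≤ z ∧ z ≤ 1) {t : ℝ} (ht : |t| ≤ 1) :
    A.expect w (fun z => Real.exp (t * (z - A.expect w id))) ≤ Real.exp (t ^ 2) := by
  set μ := A.expect w id with hμ
  have hμ0 : 0 ≤ μ := by
    simpa [hA.expect_const hw] using hA.expect_le hw (φ := fun _ => 0) (ψ := id) fun b hb => hb.1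
  have hμ1 : μ ≤ 1 := by
    simpa [hA.expect_const hw] using hA.expect_le hw (φ := id) (ψ := fun _ => 1) fun b hb => hb.2
  have key : ∀ z : ℝ, 0 ≤ z ∧ z ≤ 1 →
      Real.exp (t * (z - μ)) ≤ t * (z - μ) + (1 + t ^ 2) := by
    rintro z ⟨h0, h1⟩
    have hz : |z - μ| ≤ 1 := by rw [abs_le]; constructor <;> linarith
    have hx : |t * (z - μ)| ≤ 1 := by
      rw [abs_mul]
      exact mul_le_one₀ ht (abs_nonneg _) hz
    have h2 := (abs_le.1 (Real.abs_exp_sub_one_sub_id_le hx)).2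
    have h3 : (t * (z - μ)) ^ 2 ≤ t ^ 2 := by
      rw [mul_pow]
      exact mul_le_of_le_one_right (sq_nonneg t) (by rw [← sq_abs]; exact pow_le_one₀ (abs_nonneg _) hz)
    linarith
  refine (hA.expect_le hw key).trans ?_
  rw [expect_add, expect_const_mul, expect_sub, hA.expect_const hw, hA.expect_const hw]
  have : A.expect w (fun z => z) = μ := rfl
  rw [this, sub_self, mul_zero, zero_add]
  linarith [Real.add_one_le_exp (t ^ 2)]

open Classical in
/-- A Chernoff bound for the empirical mean of `k` runs. -/
theorem Ensures.expect_deviation_le (hw : ∀ i, 0 ≤ w i) {A : CondAlgorithm n ℝ}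
    (hA : A.Ensures w fun z => 0 ≤ z ∧ z ≤ 1) {k : ℕ} (hk : 0 < k) {η : ℝ} (hη : 0 < η)
    (hη1 : η ≤ 1) :
    (A.sumRuns k).expect w (fun s => if |s / k - A.expect w id| ≤ η then 0 else 1) ≤
      2 * Real.exp (-(k * η ^ 2 / 4)) := by
  set μ := A.expect w id with hμ
  have hS := (hA.mono fun _ hb => hb.1).sumRuns_nonneg k
  have hk0 : (0 : ℝ) < k := by exact_mod_cast hk
  have mgf : ∀ t : ℝ, |t| ≤ 1 →
      (A.sumRuns k).expect w (fun s => Real.exp (t * (s - k * μ))) ≤ Real.exp (k * t ^ 2) := by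
    intro t ht
    rw [expect_exp_sumRuns, Real.exp_nat_mul]
    exact pow_le_pow_left₀ (expect_nonneg hw (fun _ => (Real.exp_pos _).le) _)
      (hA.expect_exp_le hw ht) k
  -- Markov's inequality for both tails at once, with `t = ± η / 2`: the value `t = η / 2` minimises
  -- the exponent `k t² - t k η`, giving `-k η² / 4`.
  have key : ∀ s : ℝ, (if |s / k - μ| ≤ η then (0 : ℝ) else 1) ≤
      Real.exp (-(η / 2 * (k * η))) *
        (Real.exp (η / 2 * (s - k * μ)) + Real.exp (-(η / 2) * (s - k * μ))) := by
    intro s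
    split_ifs with h
    · positivity
    · have h1 : k * η < |s - k * μ| := by
        have : s / k - μ = (s - k * μ) / k := by field_simp
        rw [this, abs_div, abs_of_pos hk0, not_le, lt_div_iff₀ hk0] at h
        linarith
      rw [mul_add, ← Real.exp_add, ← Real.exp_add]
      rcases lt_abs.1 h1 with h2 | h2
      · have : 1 ≤ Real.exp (-(η / 2 * (k * η)) + η / 2 * (s - k * μ)) :=
          Real.one_le_exp (by nlinarith)
        linarith [Real.exp_pos (-(η / 2 * (k * η)) + -(η / 2) * (s - k * μ))]
      · have : 1 ≤ Real.exp (-(η / 2 * (k * η)) + -(η / 2) * (s - k * μ)) :=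
          Real.one_le_exp (by nlinarith)
        linarith [Real.exp_pos (-(η / 2 * (k * η)) + η / 2 * (s - k * μ))]
  refine (hS.expect_le hw fun s _ => key s).trans ?_
  rw [expect_const_mul, expect_add]
  have hη2 : |η / 2| ≤ 1 := by rw [abs_of_pos (by positivity)]; linarith
  have m1 := mgf (η / 2) hη2
  have m2 := mgf (-(η / 2)) (by rwa [abs_neg])
  rw [neg_sq] at m2
  calc _ ≤ Real.exp (-(η / 2 * (k * η))) * (Real.exp (k * (η / 2) ^ 2) +
        Real.exp (k * (η / 2) ^ 2)) := by gcongr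
    _ = 2 * (Real.exp (-(η / 2 * (k * η))) * Real.exp (k * (η / 2) ^ 2)) := by ring
    _ = _ := by
      rw [← Real.exp_add]
      congr 2
      ring

end Repetition

end CondAlgorithm

/-! ### Averaging over the cells of a partition. -/

section Cells

variable {n : ℕ} (block : Fin n → ℕ)

/-- The cell of `x` in the partition of the domain into the fibres of `block`. -/
def cell (x : Fin n) : Finset (Fin n) := {y | block y = block x}

variable {block}

theorem mem_cell {x y : Fin n} : y ∈ cell block x ↔ block y = block x := by simp [cell]

theorem self_mem_cell (x : Fin n) : x ∈ cell block x := mem_cell.2 rfl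

theorem card_cell_pos (x : Fin n) : 0 < (cell block x).card :=
  Finset.card_pos.2 ⟨x, self_mem_cell x⟩

theorem cell_eq_of_mem {x y : Fin n} (h : y ∈ cell block x) : cell block y = cell block x := by
  ext z
  rw [mem_cell, mem_cell, mem_cell.1 h]

variable (block)

/-- The weights `w` averaged over each cell. -/
def cellAverage (w : Fin n → ℝ) (x : Fin n) : ℝ :=
  (∑ y ∈ cell block x, w y) / (cell block x).card

variable {block} {w : Fin n → ℝ}

theorem cellAverage_nonneg (hw : ∀ i, 0 ≤ w i) (x : Fin n) : 0 ≤ cellAverage block w x :=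
  div_nonneg (Finset.sum_nonneg fun i _ => hw i) (Nat.cast_nonneg _)

theorem sum_cellAverage : ∑ x, cellAverage block w x = ∑ x, w x := by
  have h : ∀ x, cellAverage block w x =
      ∑ y, if block y = block x then w y / (cell block y).card else 0 := by
    intro x
    rw [cellAverage, Finset.sum_div, cell, Finset.sum_filter]
    refine Finset.sum_congr rfl fun y _ => ?_
    split_ifs with hy
    · rw [cell_eq_of_mem (mem_cell.2 hy)]
      rfl
    · rfl
  simp only [h]
  rw [Finset.sum_comm]
  refine Finset.sum_congr rfl fun y _ => ?_
  have : (0 : ℝ) < (cell block y).card := by exact_mod_cast card_cell_pos y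
  simp only [eq_comm (a := block y)]
  rw [← Finset.sum_filter, ← cell, Finset.sum_const, nsmul_eq_mul]
  field_simp

/-- The distance to the flattened distribution as an average over samples. -/
theorem tvDist_cellAverage (hw : ∀ i, 0 ≤ w i) :
    tvDist w (cellAverage block w) = ∑ x, w x * (1 - min 1 (cellAverage block w x / w x)) := by
  -- Each summand is the positive part of `w x - cellAverage block w x`, written as half of `|u| +
  -- u`; the terms linear in `u` sum to zero because averaging preserves total weight.
  have h : ∀ x, w x * (1 - min 1 (cellAverage block w x / w x)) =
      1 / 2 * |w x - cellAverage block w x| + 1 / 2 * (w x - cellAverage block w x) := by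
    intro x
    have h0 := cellAverage_nonneg (block := block) hw x
    rcases (hw x).eq_or_lt with hx | hx
    · rw [← hx, zero_sub, abs_neg, abs_of_nonneg h0]
      ring
    · rw [mul_sub, mul_min_of_nonneg _ _ hx.le, mul_div_cancel₀ _ hx.ne', mul_one]
      rcases le_total (w x) (cellAverage block w x) with h | h
      · rw [min_eq_left h, abs_of_nonpos (by linarith)]
        ring
      · rw [min_eq_right h, abs_of_nonneg (by linarith)]
        ring
  simp only [h]
  rw [Finset.sum_add_distrib, ← Finset.mul_sum, ← Finset.mul_sum, Finset.sum_sub_distrib,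
    sum_cellAverage, sub_self, mul_zero, add_zero, tvDist]

theorem tvDist_cellAverage_nonneg : 0 ≤ tvDist w (cellAverage block w) :=
  mul_nonneg (by norm_num) (Finset.sum_nonneg fun _ _ => abs_nonneg _)

theorem tvDist_cellAverage_le_one (hw : ∀ i, 0 ≤ w i) (h1 : ∑ x, w x = 1) :
    tvDist w (cellAverage block w) ≤ 1 := by
  rw [tvDist_cellAverage hw]
  refine (?_ : _ ≤ ∑ x, w x).trans h1.le
  refine Finset.sum_le_sum fun x _ => mul_le_of_le_one_right (hw x) ?_
  have : 0 ≤ min 1 (cellAverage block w x / w x) :=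
    le_min zero_le_one (div_nonneg (cellAverage_nonneg hw x) (hw x))
  linarith

variable (block w)

/-- The total weight of the points of the cell of `x` that are no heavier than `x`. -/
def lowerWeight (x : Fin n) : ℝ := ∑ y ∈ cell block x with w y ≤ w x, w y

variable {block w}

/-- The points which lie in the lower `γ`-quantile of their cell carry at most a fraction `γ` of the
total weight. -/
theorem sum_low_quantile_le (hw : ∀ i, 0 ≤ w i) {γ : ℝ} (hγ : 0 ≤ γ) :
    ∑ x with lowerWeight block w x < γ * ∑ y ∈ cell block x, w y, w x ≤ γ * ∑ x, w x := by
  rw [← Finset.sum_fiberwise_of_maps_to (t := Finset.univ.image block) (g := block)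
    (fun x _ => Finset.mem_image_of_mem _ (Finset.mem_univ x)),
    ← Finset.sum_fiberwise_of_maps_to (s := Finset.univ) (t := Finset.univ.image block) (g := block)
    (fun x _ => Finset.mem_image_of_mem _ (Finset.mem_univ x)), Finset.mul_sum]
  refine Finset.sum_le_sum fun k _ => ?_
  set B : Finset (Fin n) := {x ∈ ({x | lowerWeight block w x < γ * ∑ y ∈ cell block x, w y} :
    Finset (Fin n)) | block x = k} with hB
  rcases B.eq_empty_or_nonempty with he | hne
  · rw [he, Finset.sum_empty]
    exact mul_nonneg hγ (Finset.sum_nonneg fun i _ => hw i)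
  · obtain ⟨x, hx, hmax⟩ := B.exists_max_image w hne
    simp only [hB, Finset.mem_filter, Finset.mem_univ, true_and] at hx
    have hcell : cell block x = ({y | block y = k} : Finset (Fin n)) := by
      rw [cell, hx.2]
    have hle : ∑ y ∈ B, w y ≤ lowerWeight block w x := by
      refine Finset.sum_le_sum_of_subset_of_nonneg (fun y hy => ?_) fun y _ _ => hw y
      have hy' := hy
      simp only [hB, Finset.mem_filter, Finset.mem_univ, true_and] at hy'
      exact Finset.mem_filter.2 ⟨mem_cell.2 (hy'.2.trans hx.2.symm), hmax y hy⟩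
    rw [← hcell]
    exact hle.trans hx.1.le

end Cells

/-- With `u = min 1 (B / A)` and `v = min 1 (b / a)`, one has `u A = min A B` and `v a = min a b`,
so `a (u - v) = (a - A) u + (min A B - min a b)`. Only the true value `a` enters the denominator:
the empirical `A` may be small or zero. -/
theorem abs_min_one_div_sub_le {a b A B : ℝ} (ha : 0 < a) (hA : 0 ≤ A) (hB : 0 ≤ B) :
    |(1 - min 1 (B / A)) - (1 - min 1 (b / a))| ≤ (2 * |A - a| + |B - b|) / a := by
  set u := min 1 (B / A)
  set v := min 1 (b / a)
  have hu1 : u ≤ 1 := min_le_left _ _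
  have hu0 : 0 ≤ u := le_min zero_le_one (div_nonneg hB hA)
  have hv : v * a = min a b := by
    rw [min_mul_of_nonneg _ _ ha.le, one_mul, div_mul_cancel₀ _ ha.ne']
  have hu : u * A = min A B := by
    -- For `A = 0` the convention `B / 0 = 0` keeps the identity true, since `B ≥ 0`.
    rcases hA.eq_or_lt with h | h
    · rw [← h, mul_zero, min_eq_left hB]
    · rw [min_mul_of_nonneg _ _ hA, one_mul, div_mul_cancel₀ _ h.ne']
  have h1 : |min A B - min a b| ≤ |A - a| + |B - b| :=
    (abs_min_sub_min_le_max A B a b).trans (max_le (by linarith [abs_nonneg (B - b)])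
      (by linarith [abs_nonneg (A - a)]))
  have h2 : |(a - A) * u| ≤ |A - a| := by
    rw [abs_mul, abs_sub_comm, abs_of_nonneg hu0]
    exact mul_le_of_le_one_right (abs_nonneg _) hu1
  rw [le_div_iff₀ ha]
  calc _ = |-((a - A) * u + (min A B - min a b))| := by
        rw [← hu, ← hv, ← abs_of_pos ha, ← abs_mul, abs_of_pos ha]
        congr 1
        ring
    _ ≤ |(a - A) * u| + |min A B - min a b| := by
        rw [abs_neg]
        exact abs_add_le _ _
    _ ≤ _ := by linarith

namespace CondAlgorithm

/-! ### Estimating the ratio by pairwise comparisons. -/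

section Comparison

variable {n : ℕ} (block : Fin n → ℕ)

/-- Compare `x` with a random point `y` of its cell, drawn from the oracle: does `x` win? -/
def compareSample (x : Fin n) : CondAlgorithm n ℝ :=
  query (cell block x) fun y => query {x, y} fun z => output (if z = x then 1 else 0)

/-- Compare `x` with a uniformly random point `y` of its cell: does `y` win? -/
def compareUniform (x : Fin n) : CondAlgorithm n ℝ :=
  -- `draw m` has `m + 1` outcomes, hence the shift by one.
  draw ((cell block x).card - 1) fun j =>
    let y := (cell block x).orderEmbOfFin
      (Nat.succ_pred_eq_of_pos (card_cell_pos x)).symm j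
    query {x, y} fun z => output (if z = y then 1 else 0)

/-- A random estimate, in `[0, 1]`, of the distance to the distribution averaged over the cells. -/
def singleEstimate (M : ℕ) : CondAlgorithm n ℝ :=
  query Finset.univ fun x =>
    ((compareSample block x).sumRuns M).bind fun A =>
      ((compareUniform block x).sumRuns M).bind fun B =>
        output (1 - min 1 ((B / M) / (A / M)))

variable {block} {w : Fin n → ℝ}

theorem queries_compareSample_le (x : Fin n) : (compareSample block x).queries ≤ 2 := by
  refine Nat.add_le_add_left (m := 1) (Finset.sup_le fun y _ => ?_) 1
  simp [queries]

theorem queries_compareUniform_le (x : Fin n) : (compareUniform block x).queries ≤ 1 :=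
  Finset.sup_le fun y _ => by simp [queries]

theorem queries_singleEstimate_le (M : ℕ) : (singleEstimate block M).queries ≤ 3 * M + 1 := by
  rw [singleEstimate, queries, add_comm]
  refine Nat.add_le_add_right (Finset.sup_le fun x _ => ?_) 1
  refine (queries_bind_le (k := M * 1) (fun A => ?_) _).trans
    (Nat.add_le_add_right ((queries_sumRuns_le _ M).trans
      (Nat.mul_le_mul_left M (queries_compareSample_le x))) _) |>.trans (by omega)
  exact (queries_bind_le (k := 0) (fun B => by simp [queries]) _).trans
    ((queries_sumRuns_le _ M).trans (Nat.mul_le_mul_left M (queries_compareUniform_le x)))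

theorem compareSample_ensures {x : Fin n} (hx : 0 < w x) :
    (compareSample block x).Ensures w fun z => 0 ≤ z ∧ z ≤ 1 := by
  refine ⟨⟨x, self_mem_cell x, hx⟩, fun y _ _ => ⟨⟨x, by simp, hx⟩, fun z _ _ => ?_⟩⟩
  simp only [Ensures]
  split_ifs <;> norm_num

theorem compareUniform_ensures {x : Fin n} (hx : 0 < w x) :
    (compareUniform block x).Ensures w fun z => 0 ≤ z ∧ z ≤ 1 := by
  refine fun y => ⟨⟨x, by simp, hx⟩, fun z _ _ => ?_⟩
  simp only [Ensures]
  split_ifs <;> norm_num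

theorem singleEstimate_ensures (h1 : ∑ x, w x = 1) (M : ℕ) :
    (singleEstimate block M).Ensures w fun z => 0 ≤ z ∧ z ≤ 1 := by
  refine ⟨?_, fun x _ hx => ?_⟩
  · by_contra! h
    have : ∑ x, w x ≤ 0 := Finset.sum_nonpos h
    linarith
  · refine (((compareSample_ensures hx).mono fun _ h => h.1).sumRuns_nonneg M).bind fun A hA => ?_
    refine (((compareUniform_ensures hx).mono fun _ h => h.1).sumRuns_nonneg M).bind fun B hB => ?_
    have h0 : 0 ≤ min 1 ((B / M) / (A / M)) := le_min zero_le_one (by positivity)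
    have h1 : min 1 ((B / M) / (A / M)) ≤ 1 := min_le_left _ _
    exact ⟨by linarith, by linarith⟩

theorem expect_compareSample (x : Fin n) :
    (compareSample block x).expect w id =
      (w x * ∑ y ∈ cell block x, w y / ∑ z ∈ {x, y}, w z) / ∑ y ∈ cell block x, w y := by
  simp only [compareSample, expect, id, mul_ite, mul_one, mul_zero, Finset.sum_ite_eq',
    Finset.mem_insert, true_or, if_true, Finset.mul_sum]
  congr 1
  exact Finset.sum_congr rfl fun y _ => by ring

theorem expect_compareUniform (x : Fin n) :
    (compareUniform block x).expect w id =
      (∑ y ∈ cell block x, w y / ∑ z ∈ {x, y}, w z) / (cell block x).card := by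
  have hc := Nat.succ_pred_eq_of_pos (card_cell_pos (block := block) x)
  simp only [compareUniform, expect, id, mul_ite, mul_one, mul_zero, Finset.sum_ite_eq',
    Finset.mem_insert, Finset.mem_singleton, or_true, if_true]
  congr 1
  · set g : Fin n → ℝ := fun y => w y / ∑ z ∈ {x, y}, w z
    change ∑ j, g ((cell block x).orderEmbOfFin hc.symm j) = ∑ y ∈ cell block x, g y
    conv_rhs => rw [← Finset.map_orderEmbOfFin_univ (cell block x) hc.symm]
    rw [Finset.sum_map]
    rfl
  · exact_mod_cast hc

theorem sum_pair_nonneg (hw : ∀ i, 0 ≤ w i) (x y : Fin n) : 0 ≤ ∑ z ∈ {x, y}, w z :=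
  Finset.sum_nonneg fun i _ => hw i

theorem sum_compare_pos (hw : ∀ i, 0 ≤ w i) {x : Fin n} (hx : 0 < w x) :
    0 < ∑ y ∈ cell block x, w y / ∑ z ∈ {x, y}, w z :=
  sum_pos_of_exists (w := fun y => w y / ∑ z ∈ {x, y}, w z)
    (fun y => div_nonneg (hw y) (sum_pair_nonneg hw x y))
    ⟨x, self_mem_cell x, by simpa using div_pos hx hx⟩

theorem sum_cell_pos (hw : ∀ i, 0 ≤ w i) {x : Fin n} (hx : 0 < w x) :
    0 < ∑ y ∈ cell block x, w y :=
  sum_pos_of_exists hw ⟨x, self_mem_cell x, hx⟩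

/-- Both expectations contain the same sum of `w y / w({x, y})`, which cancels. The case `y = x` is
consistent too: the pair degenerates to `{x}` and both comparisons return `1`. -/
theorem expect_compare_div (hw : ∀ i, 0 ≤ w i) {x : Fin n} (hx : 0 < w x) :
    (compareUniform block x).expect w id / (compareSample block x).expect w id =
      cellAverage block w x / w x := by
  have h1 := sum_compare_pos (block := block) hw hx
  have h2 := sum_cell_pos (block := block) hw hx
  have h3 : (0 : ℝ) < (cell block x).card := by exact_mod_cast card_cell_pos x
  rw [expect_compareSample, expect_compareUniform, cellAverage]
  field_simp

/-- With probability at least `γ` the opponent is no heavier than `x`, and against such an opponent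
`x` wins with probability at least `1 / 2`. -/
theorem expect_compareSample_ge (hw : ∀ i, 0 ≤ w i) {x : Fin n} (hx : 0 < w x) {γ : ℝ}
    (hγ : γ * ∑ y ∈ cell block x, w y ≤ lowerWeight block w x) :
    γ / 2 ≤ (compareSample block x).expect w id := by
  rw [expect_compareSample, le_div_iff₀ (sum_cell_pos hw hx)]
  calc γ / 2 * ∑ y ∈ cell block x, w y ≤ ∑ y ∈ cell block x with w y ≤ w x, w y / 2 := by
        rw [← Finset.sum_div]
        unfold lowerWeight at hγ
        linarith
    _ ≤ ∑ y ∈ cell block x with w y ≤ w x, w x * (w y / ∑ z ∈ {x, y}, w z) := by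
        refine Finset.sum_le_sum fun y hy => ?_
        have hyx := (Finset.mem_filter.1 hy).2
        have hp : 0 < ∑ z ∈ {x, y}, w z := sum_pos_of_exists hw ⟨x, by simp, hx⟩
        have hp2 : ∑ z ∈ {x, y}, w z ≤ 2 * w x := by
          by_cases h : x = y
          · subst h
            simp only [Finset.pair_eq_singleton, Finset.sum_singleton]
            linarith
          · rw [Finset.sum_pair h]
            linarith
        rw [mul_div_assoc', div_le_div_iff₀ two_pos hp]
        nlinarith [hw y]
    _ ≤ ∑ y ∈ cell block x, w x * (w y / ∑ z ∈ {x, y}, w z) :=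
        Finset.sum_le_sum_of_subset_of_nonneg (Finset.filter_subset _ _) fun y _ _ =>
          mul_nonneg hx.le (div_nonneg (hw y) (sum_pair_nonneg hw x y))
    _ = _ := (Finset.mul_sum _ _ _).symm

/-- The bias of `singleEstimate`. -/
theorem abs_expect_singleEstimate_sub_le (hw : ∀ i, 0 ≤ w i) (h1 : ∑ x, w x = 1) {M : ℕ}
    {γ τ : ℝ} (hγ : 0 < γ) (hτ : 0 < τ) (hM : 1 ≤ τ ^ 2 * M) :
    |(singleEstimate block M).expect w id - tvDist w (cellAverage block w)| ≤ γ + 6 * τ / γ := by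
  set f : Fin n → ℝ := fun x => 1 - min 1 (cellAverage block w x / w x) with hf
  set inner : Fin n → CondAlgorithm n ℝ := fun x =>
    ((compareSample block x).sumRuns M).bind fun A =>
      ((compareUniform block x).sumRuns M).bind fun B =>
        output (1 - min 1 ((B / M) / (A / M))) with hinner
  have hexp : (singleEstimate block M).expect w id = ∑ x, w x * (inner x).expect w id := by
    rw [singleEstimate, expect, h1, div_one]
  -- Points in the lower `γ`-quantile of their cell are charged the trivial error `1`; all others
  -- have `a ≥ γ / 2` and are charged `3 τ / a ≤ 6 τ / γ`.
  have key : ∀ x, w x * |(inner x).expect w id - f x| ≤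
      (if lowerWeight block w x < γ * ∑ y ∈ cell block x, w y then w x else 0) +
        w x * (6 * τ / γ) := by
    intro x
    rcases (hw x).eq_or_lt with h0 | hx
    · simp [← h0]
    have hsE := compareSample_ensures (block := block) hx
    have huE := compareUniform_ensures (block := block) hx
    have hsN := (hsE.mono fun _ h => h.1).sumRuns_nonneg M
    have huN := (huE.mono fun _ h => h.1).sumRuns_nonneg M
    have hin : (inner x).Ensures w fun z => 0 ≤ z ∧ z ≤ 1 :=
      ((singleEstimate_ensures h1 M).2 x (Finset.mem_univ x) hx)
    have hf0 : 0 ≤ f x ∧ f x ≤ 1 := by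
      have h2 : 0 ≤ min 1 (cellAverage block w x / w x) :=
        le_min zero_le_one (div_nonneg (cellAverage_nonneg hw x) hx.le)
      have h3 : min 1 (cellAverage block w x / w x) ≤ 1 := min_le_left _ _
      exact ⟨by simp only [hf]; linarith, by simp only [hf]; linarith⟩
    have habs := hin.abs_expect_sub_le hw (φ := id) (f x)
    split_ifs with hlow
    · have : (inner x).expect w (fun b => |id b - f x|) ≤ 1 := by
        rw [← hin.expect_const hw 1]
        refine hin.expect_le hw fun b hb => ?_
        rw [id, abs_le]
        constructor <;> linarith [hb.1, hb.2, hf0.1, hf0.2]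
      have h4 : 0 ≤ w x * (6 * τ / γ) := by positivity
      nlinarith
    · rw [zero_add]
      refine mul_le_mul_of_nonneg_left (habs.trans ?_) hx.le
      set a := (compareSample block x).expect w id
      set b := (compareUniform block x).expect w id
      have haγ : γ / 2 ≤ a := expect_compareSample_ge hw hx (not_lt.1 hlow)
      have ha0 : 0 < a := by linarith
      have hfx : f x = 1 - min 1 (b / a) := by
        simp only [hf]
        rw [← expect_compare_div hw hx]
      rw [hfx]
      simp only [hinner, expect_bind, expect]
      have step : ∀ A : ℝ, 0 ≤ A → ((compareUniform block x).sumRuns M).expect w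
          (fun B => |id (1 - min 1 (B / M / (A / M))) - (1 - min 1 (b / a))|) ≤
          2 / a * |A / M - a| + τ / a := by
        intro A hA
        have h5 := huN.expect_le hw (φ := fun B =>
          |id (1 - min 1 (B / M / (A / M))) - (1 - min 1 (b / a))|)
          (ψ := fun B => 2 / a * |A / M - a| + 1 / a * |B / M - b|) fun B hB => by
            refine (abs_min_one_div_sub_le ha0 (by positivity) (by positivity)).trans ?_
            apply le_of_eq
            ring
        refine h5.trans ?_
        rw [expect_add, huN.expect_const hw, expect_const_mul]
        have h6 := huE.expect_abs_sumRuns_le hw hτ hM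
        have h7 : 1 / a * ((compareUniform block x).sumRuns M).expect w (fun B => |B / M - b|) ≤
            1 / a * τ := by gcongr
        rw [one_div_mul_eq_div _ τ] at h7
        linarith
      refine (hsN.expect_le hw step).trans ?_
      rw [expect_add, hsN.expect_const hw, expect_const_mul]
      have h6 := hsE.expect_abs_sumRuns_le hw hτ hM
      have h7 : 2 / a * ((compareSample block x).sumRuns M).expect w (fun A => |A / M - a|) ≤
          2 / a * τ := by gcongr
      have h8 : 2 / a * τ + τ / a ≤ 6 * τ / γ := by
        rw [div_mul_eq_mul_div, ← add_div, div_le_div_iff₀ ha0 hγ]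
        nlinarith
      linarith
  calc _ = |∑ x, w x * ((inner x).expect w id - f x)| := by
        rw [hexp, tvDist_cellAverage hw, ← Finset.sum_sub_distrib]
        simp only [mul_sub, hf]
    _ ≤ ∑ x, w x * |(inner x).expect w id - f x| := by
        refine (Finset.abs_sum_le_sum_abs _ _).trans (le_of_eq ?_)
        exact Finset.sum_congr rfl fun x _ => by rw [abs_mul, abs_of_nonneg (hw x)]
    _ ≤ _ := Finset.sum_le_sum fun x _ => key x
    _ ≤ _ := by
        rw [Finset.sum_add_distrib, ← Finset.sum_filter, ← Finset.sum_mul, h1, one_mul]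
        have := sum_low_quantile_le (block := block) hw hγ.le
        rw [h1, mul_one] at this
        linarith

end Comparison

end CondAlgorithm

/-! ### The oblivious decomposition as a partition into fibres. -/

section Oblivious

variable {α : ℝ}

/-- Every interval length is at least `1`, so the intervals eventually cover any point; this makes
the sets under `sInf` nonempty and excludes the default value `0`. -/
theorem le_intervalEnd (hα : 0 < α) (k : ℕ) : k ≤ intervalEnd α k := by
  calc k = ∑ j ∈ Finset.Icc 1 k, 1 := by simp
    _ ≤ _ := Finset.sum_le_sum fun j _ => by
      rw [Nat.one_le_floor_iff]
      exact one_le_pow₀ (by linarith)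

theorem intervalEnd_mono : Monotone (intervalEnd α) := fun _ _ h =>
  Finset.sum_le_sum_of_subset (Finset.Icc_subset_Icc_right h)

/-- The index of the interval of the oblivious decomposition that contains the point `i`. -/
def obliviousIndex (α : ℝ) {n : ℕ} (i : Fin n) : ℕ := sInf {k | (i : ℕ) < intervalEnd α k}

variable {n : ℕ}

theorem lt_intervalEnd_obliviousIndex (hα : 0 < α) (i : Fin n) :
    (i : ℕ) < intervalEnd α (obliviousIndex α i) :=
  Nat.sInf_mem (s := {k | (i : ℕ) < intervalEnd α k}) ⟨i + 1, le_intervalEnd hα (i + 1)⟩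

theorem one_le_obliviousIndex (hα : 0 < α) (i : Fin n) : 1 ≤ obliviousIndex α i := by
  by_contra! h
  have := lt_intervalEnd_obliviousIndex hα i
  rw [Nat.lt_one_iff.1 h] at this
  simp [intervalEnd] at this

theorem obliviousIndex_le_numIntervals (hα : 0 < α) (i : Fin n) :
    obliviousIndex α i ≤ numIntervals n α :=
  Nat.sInf_le (i.isLt.trans_le
    (Nat.sInf_mem (s := {k | n ≤ intervalEnd α k}) ⟨n, le_intervalEnd hα n⟩))

theorem mem_obliviousInterval_iff (hα : 0 < α) {k : ℕ} (hk : 1 ≤ k) (i : Fin n) :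
    i ∈ obliviousInterval n α k ↔ obliviousIndex α i = k := by
  rw [obliviousInterval, Finset.mem_filter_univ]
  constructor
  · rintro ⟨h1, h2⟩
    refine le_antisymm (Nat.sInf_le h2) ?_
    by_contra! h
    have h3 := lt_intervalEnd_obliviousIndex hα i
    have h4 : intervalEnd α (obliviousIndex α i) ≤ intervalEnd α (k - 1) :=
      intervalEnd_mono (Nat.le_sub_one_of_lt h)
    omega
  · rintro rfl
    refine ⟨?_, lt_intervalEnd_obliviousIndex hα i⟩
    by_contra! h
    have : obliviousIndex α i ≤ obliviousIndex α i - 1 := Nat.sInf_le h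
    omega

theorem flattening_eq_cellAverage (hα : 0 < α) (D : PMF (Fin n)) :
    flattening α D = cellAverage (obliviousIndex α) (massFn D) := by
  funext i
  have h1 := one_le_obliviousIndex hα i
  have hcell : obliviousInterval n α (obliviousIndex α i) = cell (obliviousIndex α) i := by
    ext j
    rw [mem_obliviousInterval_iff hα h1, mem_cell]
  rw [flattening, Finset.sum_eq_single (obliviousIndex α i), hcell, if_pos (self_mem_cell i),
    cellAverage]
  · intro k hk hki
    exact if_neg fun h => hki ((mem_obliviousInterval_iff hα (Finset.mem_Icc.1 hk).1 i).1 h).symm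
  · exact fun h => absurd (Finset.mem_Icc.2 ⟨h1, obliviousIndex_le_numIntervals hα i⟩) h

end Oblivious

/-! ### Choice of parameters, amplification and the regime of `δ` near `1`. -/

namespace CondAlgorithm

variable {n : ℕ}

/-- A uniformly random point of a grid of mesh at most `ε` in `[0, 1]`. -/
def gridGuess (n : ℕ) (ε : ℝ) : CondAlgorithm n ℝ :=
  draw ⌈1 / ε⌉₊ fun j => output (j / ⌈1 / ε⌉₊)

theorem gridGuess_ensures (w : Fin n → ℝ) (ε : ℝ) : (gridGuess n ε).Ensures w fun _ => True :=
  fun _ => trivial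

open Classical in
theorem le_expect_gridGuess (w : Fin n → ℝ) {ε d : ℝ} (hε : 0 < ε) (hε1 : ε ≤ 1) (hd : 0 ≤ d)
    (hd1 : d ≤ 1) :
    ε / 3 ≤ (gridGuess n ε).expect w fun b => if |b - d| ≤ ε then 1 else 0 := by
  set m := ⌈1 / ε⌉₊ with hm
  have hm1 : 1 / ε ≤ m := Nat.le_ceil _
  have hm2 : (m : ℝ) < 1 / ε + 1 := Nat.ceil_lt_add_one (by positivity)
  have hm0 : (0 : ℝ) < m := lt_of_lt_of_le (by positivity) hm1
  have hmε : 1 ≤ ε * m := by rwa [div_le_iff₀' hε] at hm1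
  have hfl : ⌊d * m⌋₊ < m + 1 := Nat.lt_succ_of_le (Nat.floor_le_of_le (by nlinarith))
  set j : Fin (m + 1) := ⟨⌊d * m⌋₊, hfl⟩ with hj
  have hgood : |((j : ℕ) : ℝ) / m - d| ≤ ε := by
    have h1 : ((j : ℕ) : ℝ) ≤ d * m := Nat.floor_le (by positivity)
    have h2 : d * m < ((j : ℕ) : ℝ) + 1 := Nat.lt_floor_add_one _
    rw [abs_le]
    constructor
    · rw [neg_le_sub_iff_le_add, ← sub_le_iff_le_add, le_div_iff₀ hm0]
      linarith
    · rw [sub_le_iff_le_add, div_le_iff₀ hm0]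
      nlinarith
  have hsum : (1 : ℝ) ≤ ∑ j : Fin (m + 1), if |((j : ℕ) : ℝ) / m - d| ≤ ε then 1 else 0 := by
    have := Finset.single_le_sum (f := fun j : Fin (m + 1) =>
      if |((j : ℕ) : ℝ) / m - d| ≤ ε then (1 : ℝ) else 0)
      (fun j _ => by split_ifs <;> norm_num) (Finset.mem_univ j)
    simpa only [if_pos hgood] using this
  -- The grid has `m + 1 < 1 / ε + 2` points, and `ε (1 / ε + 2) = 1 + 2 ε ≤ 3`.
  calc ε / 3 ≤ 1 / ((m : ℝ) + 1) := by
        rw [div_le_div_iff₀ (by norm_num) (by positivity)]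
        have : ε * (m + 1) ≤ ε * (1 / ε + 2) := mul_le_mul_of_nonneg_left (by linarith) hε.le
        rw [mul_add ε (1 / ε), mul_one_div_cancel hε.ne'] at this
        linarith
    _ ≤ _ := by
      simp only [gridGuess, expect]
      gcongr

/-- The average of sufficiently many independent estimates. -/
def averageEstimate (block : Fin n → ℕ) (ε δ : ℝ) : CondAlgorithm n ℝ :=
  ((singleEstimate block ⌈9216 / ε ^ 4⌉₊).sumRuns ⌈32 * Real.logb 2 (1 / δ) / ε ^ 2⌉₊).bind
    fun s => output (s / ⌈32 * Real.logb 2 (1 / δ) / ε ^ 2⌉₊)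

theorem one_le_logb_inv {δ : ℝ} (hδ : 0 < δ) (hδ2 : δ ≤ 1 / 2) : 1 ≤ Real.logb 2 (1 / δ) := by
  rw [Real.le_logb_iff_rpow_le one_lt_two (by positivity), Real.rpow_one, le_div_iff₀ hδ]
  linarith

theorem queries_averageEstimate_le (block : Fin n → ℕ) {ε δ : ℝ} (hε : 0 < ε) (hε1 : ε ≤ 1)
    (hδ : 0 < δ) (hδ2 : δ ≤ 1 / 2) :
    ((averageEstimate block ε δ).queries : ℝ) ≤ 1000000 * (1 / ε) ^ 6 * Real.logb 2 (1 / δ) := by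
  set L := Real.logb 2 (1 / δ) with hL
  have hL1 : 1 ≤ L := one_le_logb_inv hδ hδ2
  set e := 1 / ε with he
  have he1 : 1 ≤ e := by rw [he, le_div_iff₀ hε]; linarith
  set M := ⌈9216 / ε ^ 4⌉₊
  set N := ⌈32 * L / ε ^ 2⌉₊
  have h : (averageEstimate block ε δ).queries ≤ N * (3 * M + 1) :=
    ((queries_bind_le (k := 0) (fun _ => by simp [queries]) _).trans (queries_sumRuns_le _ _)).trans
      (Nat.mul_le_mul_left _ (queries_singleEstimate_le _))
  have hM : (M : ℝ) ≤ 9217 * e ^ 4 := by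
    have h1 : (M : ℝ) < 9216 / ε ^ 4 + 1 := Nat.ceil_lt_add_one (by positivity)
    have h2 : 9216 / ε ^ 4 = 9216 * e ^ 4 := by rw [he, one_div_pow, mul_one_div]
    linarith [one_le_pow₀ he1 (n := 4)]
  have hN : (N : ℝ) ≤ 33 * L * e ^ 2 := by
    have h1 : (N : ℝ) < 32 * L / ε ^ 2 + 1 := Nat.ceil_lt_add_one (by positivity)
    have h2 : 32 * L / ε ^ 2 = 32 * L * e ^ 2 := by rw [he, one_div_pow, mul_one_div]
    nlinarith [one_le_pow₀ he1 (n := 2)]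
  have h4 := one_le_pow₀ he1 (n := 4)
  calc ((averageEstimate block ε δ).queries : ℝ) ≤ ((N * (3 * M + 1) : ℕ) : ℝ) := by exact_mod_cast h
    _ = N * (3 * M + 1) := by push_cast; ring
    _ ≤ (33 * L * e ^ 2) * (27652 * e ^ 4) := by gcongr; linarith
    _ = 912516 * (e ^ 6 * L) := by ring
    _ ≤ 1000000 * (e ^ 6 * L) := by gcongr; norm_num
    _ = _ := by ring

variable {w : Fin n → ℝ} {block : Fin n → ℕ}

theorem averageEstimate_ensures (h1 : ∑ x, w x = 1) (ε δ : ℝ) :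
    (averageEstimate block ε δ).Ensures w fun _ => True :=
  (((singleEstimate_ensures h1 _).mono fun _ h => h.1).sumRuns_nonneg _).bind fun _ _ => trivial

open Classical in
theorem le_expect_averageEstimate (hw : ∀ i, 0 ≤ w i) (h1 : ∑ x, w x = 1) {ε δ : ℝ} (hε : 0 < ε)
    (hε1 : ε ≤ 1) (hδ : 0 < δ) (hδ2 : δ ≤ 1 / 2) :
    1 - δ ≤ (averageEstimate block ε δ).expect w fun b =>
      if |b - tvDist w (cellAverage block w)| ≤ ε then 1 else 0 := by
  set L := Real.logb 2 (1 / δ) with hL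
  have hL1 : 1 ≤ L := one_le_logb_inv hδ hδ2
  set d := tvDist w (cellAverage block w)
  set M := ⌈9216 / ε ^ 4⌉₊
  set N := ⌈32 * L / ε ^ 2⌉₊ with hN
  -- `9216 = 96²`, so `M ≥ τ⁻²` for `τ = ε² / 96`; together with `γ = ε / 4` both parts of the bias
  -- `γ + 6 τ / γ` equal `ε / 4`.
  have hM : 1 ≤ (ε ^ 2 / 96) ^ 2 * M := by
    have h2 : 9216 / ε ^ 4 ≤ M := Nat.le_ceil _
    rw [div_le_iff₀ (by positivity)] at h2
    linarith
  have hN1 : 32 * L ≤ N * ε ^ 2 := by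
    have h2 : 32 * L / ε ^ 2 ≤ N := Nat.le_ceil _
    rwa [div_le_iff₀ (by positivity)] at h2
  have hN0 : 0 < N := Nat.ceil_pos.2 (by positivity)
  have hE := singleEstimate_ensures (block := block) h1 M
  have hS := (hE.mono fun _ h => h.1).sumRuns_nonneg N
  set μ := (singleEstimate block M).expect w id
  have hbias : |μ - d| ≤ ε / 2 := by
    have := abs_expect_singleEstimate_sub_le (block := block) hw h1 (γ := ε / 4)
      (τ := ε ^ 2 / 96) (by positivity) (by positivity) hM
    have h2 : ε / 4 + 6 * (ε ^ 2 / 96) / (ε / 4) = ε / 2 := by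
      field_simp
      ring
    rwa [h2] at this
  have hdev := hE.expect_deviation_le hw hN0 (η := ε / 2) (by positivity) (by linarith)
  have htail : 2 * Real.exp (-(N * (ε / 2) ^ 2 / 4)) ≤ δ := by
    -- Here `δ ≤ 1 / 2` enters: `L ≥ 1` absorbs the factor `2` of the two-sided tail. The constant
    -- `32` then makes the Chernoff exponent `N ε² / 16` at least `2 L`.
    have hlog : Real.log (2 / δ) ≤ 2 * L := by
      have h2 : Real.log (2 / δ) = Real.log 2 * (1 + L) := by
        rw [hL, Real.logb, mul_add, mul_div_cancel₀ _ (Real.log_pos one_lt_two).ne', mul_one,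
          ← Real.log_mul (by norm_num) (by positivity), mul_one_div]
      rw [h2]
      nlinarith [Real.log_two_lt_d9]
    have h3 : -(N * (ε / 2) ^ 2 / 4) ≤ -Real.log (2 / δ) := by linarith
    calc _ ≤ 2 * Real.exp (-Real.log (2 / δ)) := by gcongr
      _ = δ := by
        rw [Real.exp_neg, Real.exp_log (by positivity)]
        field_simp
  have key : ∀ s : ℝ, 1 - (if |s / N - μ| ≤ ε / 2 then (0 : ℝ) else 1) ≤
      if |s / N - d| ≤ ε then 1 else 0 := by
    intro s
    by_cases h : |s / N - μ| ≤ ε / 2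
    · have : |s / N - d| ≤ ε := (abs_sub_le _ μ _).trans (by linarith)
      rw [if_pos h, if_pos this, sub_zero]
    · rw [if_neg h, sub_self]
      split_ifs <;> norm_num
  calc 1 - δ ≤ 1 - ((singleEstimate block M).sumRuns N).expect w
        (fun s => if |s / N - μ| ≤ ε / 2 then 0 else 1) := by linarith
    _ = ((singleEstimate block M).sumRuns N).expect w
        (fun s => 1 - if |s / N - μ| ≤ ε / 2 then 0 else 1) := by
      rw [expect_sub, hS.expect_const hw]
    _ ≤ ((singleEstimate block M).sumRuns N).expect w
        (fun s => if |s / N - d| ≤ ε then 1 else 0) := hS.expect_le hw fun s _ => key s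
    _ = _ := by
      rw [averageEstimate, expect_bind]
      rfl

/-- Estimates the distance to the flattened distribution.  If the required success probability is at
most `ε / 3`, a blind guess is enough. -/
def distanceEstimate (n : ℕ) (α ε δ : ℝ) : CondAlgorithm n ℝ :=
  if 1 - δ ≤ ε / 3 then gridGuess n ε
  else averageEstimate (obliviousIndex α) ε (min δ (1 / 2))

theorem queries_distanceEstimate_le (n : ℕ) (α : ℝ) {ε δ : ℝ} (hε : 0 < ε) (hε1 : ε ≤ 1)
    (hδ : 0 < δ) (hδ1 : δ ≤ 1) :
    ((distanceEstimate n α ε δ).queries : ℝ) ≤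
      3000000 * ((1 / ε) ^ 7 * Real.logb 2 (1 / δ)) := by
  have hL0 : 0 ≤ Real.logb 2 (1 / δ) :=
    Real.logb_nonneg one_lt_two (by rw [le_div_iff₀ hδ]; linarith)
  have he1 : 1 ≤ 1 / ε := by rw [le_div_iff₀ hε]; linarith
  rw [distanceEstimate]
  split_ifs with h
  · simp only [gridGuess, queries, Finset.sup_const Finset.univ_nonempty, Nat.cast_zero]
    positivity
  · refine (queries_averageEstimate_le _ hε hε1 (lt_min hδ (by norm_num))
      (min_le_right _ _)).trans ?_
    -- For `δ ≥ 1 / 2` the left side is `1`, whereas `log₂ (1 / δ) ≥ 1 - δ > ε / 3` since the blind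
    -- guess was not taken.
    have hL : Real.logb 2 (1 / min δ (1 / 2)) ≤ 3 * (1 / ε) * Real.logb 2 (1 / δ) := by
      rcases le_total δ (1 / 2) with h2 | h2
      · rw [min_eq_left h2]
        exact le_mul_of_one_le_left hL0 (by linarith)
      · have h3 : Real.logb 2 (1 / min δ (1 / 2)) = 1 := by
          rw [min_eq_right h2, one_div_one_div, Real.logb_self_eq_one one_lt_two]
        have h4 : 1 - δ ≤ Real.logb 2 (1 / δ) := by
          have h5 : 1 - δ ≤ Real.log (1 / δ) := by
            rw [one_div, Real.log_inv]
            linarith [Real.log_le_sub_one_of_pos hδ]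
          rw [Real.logb, le_div_iff₀ (Real.log_pos one_lt_two)]
          nlinarith [Real.log_two_lt_d9]
        rw [h3, mul_one_div, div_mul_eq_mul_div, le_div_iff₀ hε]
        linarith
    calc _ ≤ 1000000 * (1 / ε) ^ 6 * (3 * (1 / ε) * Real.logb 2 (1 / δ)) := by gcongr
      _ = _ := by ring

theorem distanceEstimate_ensures (D : PMF (Fin n)) (α ε δ : ℝ) :
    (distanceEstimate n α ε δ).Ensures (massFn D) fun _ => True := by
  rw [distanceEstimate]
  split_ifs
  exacts [gridGuess_ensures _ _, averageEstimate_ensures sum_massFn _ _]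

open Classical in
theorem le_expect_distanceEstimate (D : PMF (Fin n)) {α ε δ : ℝ} (hα : 0 < α) (hε : 0 < ε)
    (hε1 : ε ≤ 1) (hδ : 0 < δ) :
    1 - δ ≤ (distanceEstimate n α ε δ).expect (massFn D) fun b =>
      if |b - tvDist (massFn D) (flattening α D)| ≤ ε then 1 else 0 := by
  rw [flattening_eq_cellAverage hα, distanceEstimate]
  split_ifs with h
  · exact h.trans (le_expect_gridGuess _ hε hε1 tvDist_cellAverage_nonneg
      (tvDist_cellAverage_le_one massFn_nonneg sum_massFn))
  · exact (sub_le_sub_left (min_le_left δ (1 / 2)) 1).trans (le_expect_averageEstimate massFn_nonneg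
      sum_massFn hε hε1 (lt_min hδ (by norm_num)) (min_le_right _ _))

end CondAlgorithm

end

theorem mainTheorem12 :
    ∃ (C : ℝ) (c : ℕ) (A : (n : ℕ) → (α ε δ : ℝ) → CondAlgorithm n ℝ),
      ∀ (n : ℕ) (α ε δ : ℝ), 0 < α → 0 < ε → ε ≤ 1 → 0 < δ → δ ≤ 1 →
        ((A n α ε δ).queries : ℝ) ≤
            C * ((1 / ε) ^ 22 * (1 + Real.logb 2 (1 / ε)) ^ c * Real.logb 2 (1 / δ)) ∧
        ∀ D : PMF (Fin n),
          none ∉ ((A n α ε δ).run D).support ∧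
          ENNReal.ofReal (1 - δ) ≤
            ((A n α ε δ).run D).toOuterMeasure
              {o | ∃ d : ℝ, o = some d ∧ |d - tvDist (massFn D) (flattening α D)| ≤ ε} := by
  -- No logarithmic factor is needed, as the algorithm's exponent `7` is below `22`.
  refine ⟨3000000, 0, CondAlgorithm.distanceEstimate,
    fun n α ε δ hα hε hε1 hδ hδ1 => ⟨?_, fun D => ?_⟩⟩
  · refine (CondAlgorithm.queries_distanceEstimate_le n α hε hε1 hδ hδ1).trans ?_
    have hL0 : 0 ≤ Real.logb 2 (1 / δ) :=
      Real.logb_nonneg one_lt_two (by rw [le_div_iff₀ hδ]; linarith)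
    have he1 : 1 ≤ 1 / ε := by rw [le_div_iff₀ hε]; linarith
    rw [pow_zero, mul_one]
    gcongr
    norm_num
  · have hA := CondAlgorithm.distanceEstimate_ensures D α ε δ
    refine ⟨hA.none_notMem_support, ?_⟩
    rw [hA.toOuterMeasure_run]
    exact ENNReal.ofReal_le_ofReal
      (CondAlgorithm.le_expect_distanceEstimate D hα hε hε1 hδ)
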